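/- Let $T>0$ and let $X=(X_t)_{t\in[0,T]}$ be a centered Gaussian process on a probability space $(\Omega,\mathcal F,\mathbb P)$ with $\sup_{t\in[0,T]}\mathbb E[X_t^2]<\infty$. Suppose that there are a kernel $K\in L^2([0,T]^2)$, with $K(t,\cdot)\in L^2([0,T])$ for every $t$, and a standard Brownian motion $W=(W_t)_{t\in[0,T]}$ on the same probability space such that, for every $t\in[0,T]$, almost surely $$X_t=\int_0^T K(t,s)\,dW_s \quad\text{(Wiener integral)},$$ and such that $H^X_T=H^W_T$, where $H^Z_T$ is the closure in $L^2(\Omega)$ of the linear span of $\{Z_s: s\in[0,T]\}$. Let $0\le t_L^1<t_U^1<t_L^2<\dots<t_L^n<t_U^n\le T$, let $\Delta=\bigcup_{k=1}^n[t_L^k,t_U^k]$, and let $\mathcal F_\Delta=\sigma(X_t:t\in\Delta)$. For each $t\in[0,T]\setminus\Delta$ there is exactly one $f_t\in L^2([0,T])$ such that $$\int_0^T f_t(s)K(u,s)\,ds=\int_0^T K(t,s)K(u,s)\,ds\quad\text{for all }u\in\Delta,$$ and $\int_0^T f_t(s)g(s)\,ds=0$ for all $g\in L^2([0,T])$ with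 $\int_0^T g(s)K(u,s)\,ds=0$ for all $u\in\Delta$. For this $f_t$, $$\hat X_t:=\mathbb E[X_t\mid\mathcal F_\Delta]=\int_0^T f_t(s)\,dW_s\quad\text{almost surely}.$$ The process $X$, viewed as a random element of $\mathbb R^{[0,T]}$ with the product $\sigma$-algebra, has a regular conditional law $\kappa$ given $\mathcal F_\Delta$ such that, for every $\omega$, $\kappa(\omega,\cdot)$ is a Gaussian law (all its finite-dimensional marginals are Gaussian) whose mean at each $t\in[0,T]\setminus\Delta$ is $\hat X_t(\omega)$ (for a version of $\hat X_t$) and whose covariance is deterministic and given, for $t,s\in[0,T]\setminus\Delta$, by $$\rho(t,s\mid\Delta)=\int_0^T\left[K(t,u)-f_t(u)\right]\left[K(s,u)-f_s(u)\right]du.$$ The regular conditional law is unique in the sense that, for any regular conditional law $\kappa'$ of $X$ given $\mathcal F_\Delta$ and any finite $J\subset[0,T]$, the $J$-marginals of $\kappa'(\omega,\cdot)$ and $\kappa(\omega,\cdot)$ agree for almost every $\omega$. -/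

import Mathlib

open MeasureTheory ProbabilityTheory Filter Topology

noncomputable section

/-- The time interval `[0, T]`, carrying the order and the Lebesgue measure (`volume`) of `ℝ`. -/
abbrev TimeInterval (T : ℝ) : Type := Set.Icc (0 : ℝ) T

instance (T : ℝ) : MeasureSpace (TimeInterval T) where
  volume := (volume : Measure ℝ).comap Subtype.val

/-- The step function `∑ₜ cₜ 1_[0,t)` on `[0, T]`. -/
def stepFunction {T : ℝ} (c : TimeInterval T →₀ ℝ) (s : TimeInterval T) : ℝ :=
  c.sum fun t a => a * (Set.Iio t).indicator 1 s

/-- The elementary integral `∑ₜ cₜ Wₜ` of the step function `∑ₜ cₜ 1_[0,t)` with respect to `W`. -/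
def elementaryIntegral {T : ℝ} {Ω : Type*} (W : TimeInterval T → Ω → ℝ)
    (c : TimeInterval T →₀ ℝ) (ω : Ω) : ℝ :=
  c.sum fun t a => a * W t ω

/-- `ξ` is (a version of) the Wiener integral `∫₀ᵀ f(s) dWₛ`: the linear extension of
`1_[0,t) ↦ Wₜ`, extended by `L²`-continuity, sends `f ∈ L²([0,T])` to `ξ ∈ L²(Ω)`. -/
def IsWienerIntegral {T : ℝ} {Ω : Type*} [MeasurableSpace Ω] (P : Measure Ω)
    (W : TimeInterval T → Ω → ℝ) (f : TimeInterval T → ℝ) (ξ : Ω → ℝ) : Prop :=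
  MemLp f 2 volume ∧ MemLp ξ 2 P ∧
    ∃ c : ℕ → (TimeInterval T →₀ ℝ),
      Tendsto (fun n => eLpNorm (f - stepFunction (c n)) 2 volume) atTop (𝓝 0) ∧
      Tendsto (fun n => eLpNorm (ξ - elementaryIntegral W (c n)) 2 P) atTop (𝓝 0)

/-- `W` is a standard Brownian motion on the time interval `[0, T]`. -/
structure IsBrownianMotionOn {T : ℝ} {Ω : Type*} [MeasurableSpace Ω] (P : Measure Ω)
    (W : TimeInterval T → Ω → ℝ) : Prop where
  gaussian : IsGaussianProcess W P
  centered : ∀ t, ∫ ω, W t ω ∂P = 0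
  covariance : ∀ s t, cov[W s, W t; P] = min (s : ℝ) (t : ℝ)
  continuous_paths : ∀ᵐ ω ∂P, Continuous fun t => W t ω

/-- The first chaos `H^X_T`: the closure in `L²(Ω)` of the linear span of the `Xₜ`,
`t ∈ [0, T]`. -/
def firstChaos {T : ℝ} {Ω : Type*} [MeasurableSpace Ω] (P : Measure Ω)
    (X : TimeInterval T → Ω → ℝ) : Submodule ℝ (Lp ℝ 2 P) :=
  (Submodule.span ℝ {ξ : Lp ℝ 2 P | ∃ t, (ξ : Ω → ℝ) =ᵐ[P] X t}).topologicalClosure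

/-- `X` is a centered Gaussian process on `[0, T]` with uniformly bounded variance, with the exact
Fredholm representation `Xₜ = ∫₀ᵀ K(t,s) dWₛ` for a kernel `K ∈ L²([0,T]²)` and a Brownian motion
`W`, and with `H^X_T = H^W_T`. -/
structure HasFredholmRepresentation {T : ℝ} {Ω : Type*} [MeasurableSpace Ω] (P : Measure Ω)
    (X : TimeInterval T → Ω → ℝ) (K : TimeInterval T → TimeInterval T → ℝ)
    (W : TimeInterval T → Ω → ℝ) : Prop where
  measurable : ∀ t, Measurable (X t)
  gaussian : IsGaussianProcess X P
  centered : ∀ t, ∫ ω, X t ω ∂P = 0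
  bounded_variance : BddAbove (Set.range fun t => ∫ ω, X t ω ^ 2 ∂P)
  kernel_memLp : MemLp (Function.uncurry K) 2 volume
  brownian : IsBrownianMotionOn P W
  fredholm : ∀ t, IsWienerIntegral P W (K t) (X t)
  firstChaos_eq : firstChaos P X = firstChaos P W

/-- The `σ`-algebra `σ(Xₜ : t ∈ Δ)`. -/
abbrev observedSigma {T : ℝ} {Ω : Type*} (X : TimeInterval T → Ω → ℝ) (Δ : Set (TimeInterval T)) :
    MeasurableSpace Ω :=
  ⨆ t ∈ Δ, MeasurableSpace.comap (X t) inferInstance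

/-- `g ∈ L²([0,T])` solves `∫ g(s) K(u,s) ds = ∫ K(t,s) K(u,s) ds` for all `u ∈ Δ`, and is
orthogonal to every `h ∈ L²([0,T])` with `∫ h(s) K(u,s) ds = 0` for all `u ∈ Δ`. -/
structure IsPredictionKernel {T : ℝ} (K : TimeInterval T → TimeInterval T → ℝ)
    (Δ : Set (TimeInterval T)) (t : TimeInterval T) (g : TimeInterval T → ℝ) : Prop where
  memLp : MemLp g 2 volume
  system : ∀ u ∈ Δ, ∫ s, g s * K u s = ∫ s, K t s * K u s
  orthogonal : ∀ h : TimeInterval T → ℝ, MemLp h 2 volume →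
    (∀ u ∈ Δ, ∫ s, h s * K u s = 0) → ∫ s, g s * h s = 0

/-- `κ` is a regular conditional law of the process `X`, as a random element of `ℝ^[0,T]` with the
product `σ`-algebra, given the `σ`-algebra `m`: each `κ ω` is a probability measure, and for every
measurable `A` the map `ω ↦ κ ω A` is `m`-measurable (part of `Kernel`) and a version of
`P(X ∈ A | m)`. -/
structure IsRegularCondLaw {T : ℝ} {Ω : Type*} [MeasurableSpace Ω] (P : Measure Ω)
    (X : TimeInterval T → Ω → ℝ) (m : MeasurableSpace Ω)
    (κ : @Kernel Ω (TimeInterval T → ℝ) m MeasurableSpace.pi) : Prop where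
  isProbabilityMeasure : ∀ ω, IsProbabilityMeasure (κ ω)
  condProb : ∀ A : Set (TimeInterval T → ℝ), MeasurableSet A →
    (fun ω => (κ ω).real A) =ᵐ[P] P⟦{ω | (fun t => X t ω) ∈ A} | m⟧

end

/-! Wiener integration is an isometry from L²([0,T]) into L²(Ω), handled here through its graph, the
closed span of the pairs (1_[0,t), Wₜ) (`isWienerIntegral_iff`). The Fredholm representation puts
each (K(t,·), Xₜ) in this graph, so the Hilbert geometry of the kernels is that of the process. The
prediction kernel f_t is the orthogonal projection of K(t,·) to the closed span of the K(u,·), u ∈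
Δ. Its Wiener integral lies in the closed span of the Xᵤ, and the error, Xₜ minus this integral, is
orthogonal to every Xᵤ (`inner_processLp_sub_predictor`).

Centered Gaussian laws survive L² limits (`isClosed_setOf_map_eq_gaussianReal`), so observations and
errors are jointly Gaussian and orthogonality becomes independence (`indep_observedSigma`). Hence
the Wiener integral of f_t is the conditional expectation, and the conditional law is the fixed law
of the error process translated by the predictor (`isRegularCondLaw_shiftKernel`). Mean, covariance
and Gaussianity are read off from this. Uniqueness of finite marginals rests on ℝ^J being countably
generated (`IsRegularCondLaw.ae_map_restrict_eq`). -/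

noncomputable section

/-! ### Centered Gaussian variables and L² limits -/

section GaussianClosure

open Complex in
theorem norm_cexp_mul_I_sub_le (a b : ℝ) : ‖cexp (a * I) - cexp (b * I)‖ ≤ |a - b| := by
  have h : cexp (a * I) - cexp (b * I) = cexp (b * I) * (cexp (I * ((a - b : ℝ) : ℂ)) - 1) := by
    rw [mul_sub, ← Complex.exp_add, mul_one]
    congr 2
    push_cast
    ring
  rw [h, norm_mul, Complex.norm_exp_ofReal_mul_I, one_mul]
  exact Real.norm_exp_I_mul_ofReal_sub_one_le

variable {Ω : Type*} [MeasurableSpace Ω] {P : Measure Ω}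

theorem integral_abs_le_norm_Lp_two [IsProbabilityMeasure P] (ξ : Lp ℝ 2 P) :
    ∫ ω, |ξ ω| ∂P ≤ ‖ξ‖ := by
  have hξ := Lp.memLp ξ
  have h1 : ∫ ω, |ξ ω| ∂P = (eLpNorm ξ 1 P).toReal := by
    rw [eLpNorm_one_eq_lintegral_enorm, ← integral_norm_eq_lintegral_enorm hξ.1]
    rfl
  rw [h1, Lp.norm_def]
  exact ENNReal.toReal_mono hξ.2.ne
    (eLpNorm_le_eLpNorm_of_exponent_le (by norm_num) hξ.1)

/-- Since x ↦ exp(ix) is 1-Lipschitz and the L¹ norm is at most the L² norm on a probability space,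
characteristic functions vary continuously along L² convergence. -/
theorem norm_charFun_map_sub_le [IsProbabilityMeasure P] (ξ η : Lp ℝ 2 P) (t : ℝ) :
    ‖charFun (P.map ξ) t - charFun (P.map η) t‖ ≤ |t| * ‖ξ - η‖ := by
  have hm : ∀ ζ : Lp ℝ 2 P, AEMeasurable ζ P := fun ζ => (Lp.aestronglyMeasurable ζ).aemeasurable
  have hc : ∀ ζ : Lp ℝ 2 P,
      charFun (P.map ζ) t = ∫ ω, Complex.exp ((t * ζ ω : ℝ) * Complex.I) ∂P := by
    intro ζ
    rw [charFun_apply_real, integral_map (hm ζ) (by fun_prop)]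
    simp
  have hi : ∀ ζ : Lp ℝ 2 P, Integrable (fun ω => Complex.exp ((t * ζ ω : ℝ) * Complex.I)) P := by
    intro ζ
    refine Integrable.of_bound (C := 1) ?_ (ae_of_all _ fun ω => ?_)
    · have := hm ζ
      exact AEMeasurable.aestronglyMeasurable (by fun_prop)
    · rw [Complex.norm_exp_ofReal_mul_I]
  rw [hc, hc, ← integral_sub (hi ξ) (hi η)]
  calc _ ≤ ∫ ω, |t| * |(ξ - η : Lp ℝ 2 P) ω| ∂P := by
        refine norm_integral_le_of_norm_le ?_ ?_
        · exact (((Lp.memLp (ξ - η)).integrable (by norm_num)).abs).const_mul _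
        · filter_upwards [Lp.coeFn_sub ξ η] with ω hω
          refine (norm_cexp_mul_I_sub_le _ _).trans ?_
          rw [hω, ← abs_mul, Pi.sub_apply, mul_sub]
    _ = |t| * ∫ ω, |(ξ - η : Lp ℝ 2 P) ω| ∂P := integral_const_mul _ _
    _ ≤ _ := by gcongr; exact integral_abs_le_norm_Lp_two _

/-- A law is determined by its characteristic function, so the condition is a family of equations,
one for each t, with both sides continuous in ξ. Writing the variance as ‖ξ‖² makes it pass to the
limit automatically. -/
theorem isClosed_setOf_map_eq_gaussianReal [IsProbabilityMeasure P] :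
    IsClosed {ξ : Lp ℝ 2 P | P.map ξ = gaussianReal 0 (‖ξ‖ ^ 2).toNNReal} := by
  have hm : ∀ ζ : Lp ℝ 2 P, AEMeasurable ζ P := fun ζ => (Lp.aestronglyMeasurable ζ).aemeasurable
  have hset : {ξ : Lp ℝ 2 P | P.map ξ = gaussianReal 0 (‖ξ‖ ^ 2).toNNReal} =
      ⋂ t : ℝ, {ξ : Lp ℝ 2 P | charFun (P.map ξ) t =
        Complex.exp (-((‖ξ‖ ^ 2 : ℝ) * t ^ 2 / 2))} := by
    ext ξ
    simp only [Set.mem_ofPred_eq, Set.mem_iInter]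
    have hg : ∀ t, charFun (gaussianReal 0 (‖ξ‖ ^ 2).toNNReal) t =
        Complex.exp (-((‖ξ‖ ^ 2 : ℝ) * t ^ 2 / 2)) := by
      intro t
      rw [charFun_gaussianReal, Real.coe_toNNReal _ (by positivity)]
      simp
    refine ⟨fun h t => by rw [h, hg], fun h => ?_⟩
    have := Measure.isProbabilityMeasure_map (hm ξ)
    exact Measure.ext_of_charFun (funext fun t => by rw [h, hg])
  rw [hset]
  refine isClosed_iInter fun t => isClosed_eq ?_ (by fun_prop)
  refine (LipschitzWith.of_dist_le_mul (K := ⟨|t|, abs_nonneg t⟩) fun ξ η => ?_).continuous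
  rw [dist_eq_norm, dist_eq_norm]
  exact norm_charFun_map_sub_le ξ η t

/-- Every family in a linear space of centered Gaussian variables is a Gaussian process. -/
theorem isGaussianProcess_of_forall_mem (H : Submodule ℝ (Lp ℝ 2 P))
    (hH : ∀ ξ ∈ H, P.map ξ = gaussianReal 0 (‖ξ‖ ^ 2).toNNReal)
    {ι : Type*} (Z : ι → Ω → ℝ) (ζ : ι → Lp ℝ 2 P) (hζ : ∀ i, ζ i ∈ H)
    (hZ : ∀ i, Z i =ᵐ[P] ζ i) : IsGaussianProcess Z P := by
  have key : IsGaussianProcess (fun i => (ζ i : Ω → ℝ)) P := by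
    refine ⟨fun I => ⟨?_⟩⟩
    have hm : AEMeasurable (fun ω => I.restrict fun i => (ζ i : Ω → ℝ) ω) P :=
      aemeasurable_pi_lambda _ fun i => (Lp.aestronglyMeasurable (ζ i)).aemeasurable
    refine isGaussian_of_isGaussian_map fun L => ?_
    rw [AEMeasurable.map_map_of_aemeasurable (by fun_prop) hm]
    classical
    have hL : ∀ v : I → ℝ, L v = ∑ i, v i * L (Pi.single i 1) := by
      intro v
      conv_lhs => rw [← Finset.univ_sum_single v, map_sum]
      refine Finset.sum_congr rfl fun i _ => ?_
      rw [← smul_eq_mul, ← map_smul, ← Pi.single_smul, smul_eq_mul, mul_one]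
    -- By Cramér–Wold it suffices to treat one linear functional, and its value on the family is
    -- again an element of H.
    set η : Lp ℝ 2 P := ∑ i : I, L (Pi.single i 1) • ζ i with hη
    have hηH : η ∈ H := Submodule.sum_mem _ fun i _ => H.smul_mem _ (hζ i)
    have hae : (L ∘ fun ω => I.restrict fun i => (ζ i : Ω → ℝ) ω) =ᵐ[P] η := by
      have h1 : ∀ᵐ ω ∂P, ∀ i : I, (L (Pi.single i 1) • ζ i : Lp ℝ 2 P) ω =
          L (Pi.single i 1) * ζ i ω :=
        ae_all_iff.2 fun i => Lp.coeFn_smul (L (Pi.single i 1)) (ζ i.1)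
      filter_upwards [h1, Lp.coeFn_finsetSum Finset.univ
        fun i : I => L (Pi.single i 1) • ζ i] with ω h1 h2
      rw [hη, h2, Finset.sum_apply, Function.comp_apply, hL]
      refine Finset.sum_congr rfl fun i _ => ?_
      rw [h1 i, mul_comm]
      rfl
    rw [Measure.map_congr hae, hH η hηH]
    infer_instance
  exact key.congr fun i => (hZ i).symm

theorem map_eq_gaussianReal_of_mem_closure_span [IsProbabilityMeasure P] {ι : Type*}
    {X : ι → Ω → ℝ}
    (hX : IsGaussianProcess X P) (h0 : ∀ i, ∫ ω, X i ω ∂P = 0) (x : ι → Lp ℝ 2 P)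
    (hx : ∀ i, x i =ᵐ[P] X i) {ξ : Lp ℝ 2 P}
    (hξ : ξ ∈ (Submodule.span ℝ (Set.range x)).topologicalClosure) :
    P.map ξ = gaussianReal 0 (‖ξ‖ ^ 2).toNNReal := by
  refine closure_minimal (s := (Submodule.span ℝ (Set.range x) : Set (Lp ℝ 2 P)))
    (fun ξ hξ => ?_) isClosed_setOf_map_eq_gaussianReal hξ
  obtain ⟨c, rfl⟩ := Finsupp.mem_span_range_iff_exists_finsupp.1 hξ
  have hae : ((c.sum fun i a => a • x i : Lp ℝ 2 P) : Ω → ℝ) =ᵐ[P]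
      fun ω => ∑ i ∈ c.support, c i * X i ω := by
    have h1 : ∀ᵐ ω ∂P, ∀ i ∈ c.support, (c i • x i : Lp ℝ 2 P) ω = c i * X i ω := by
      refine (ae_ball_iff c.support.countable_toSet).2 fun i _ => ?_
      filter_upwards [Lp.coeFn_smul (c i) (x i), hx i] with ω h1 h2
      rw [h1, Pi.smul_apply, h2, smul_eq_mul]
    filter_upwards [h1, Lp.coeFn_finsetSum c.support fun i => c i • x i] with ω h1 h2
    rw [Finsupp.sum, h2, Finset.sum_apply]
    exact Finset.sum_congr rfl fun i hi => h1 i hi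
  set η : Lp ℝ 2 P := c.sum fun i a => a • x i
  have hg : HasGaussianLaw η P :=
    ((hX.smul c).hasGaussianLaw_fun_sum (I := c.support)).congr hae.symm
  have hmean : ∫ ω, η ω ∂P = 0 := by
    rw [integral_congr_ae hae, integral_finsetSum]
    · simp [integral_const_mul, h0]
    · exact fun i _ => ((hX.hasGaussianLaw_eval i).integrable).const_mul _
  have hvar : Var[η; P] = ‖η‖ ^ 2 := by
    rw [variance_of_integral_eq_zero hg.aemeasurable hmean, ← real_inner_self_eq_norm_sq,
      L2.inner_def]
    refine integral_congr_ae (ae_of_all _ fun ω => ?_)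
    simp [sq]
  show P.map η = _
  rw [hg.map_eq_gaussianReal, hmean, hvar]

end GaussianClosure

/-! ### Isometries as closed graphs in a product of Hilbert spaces -/

section HilbertGraph

open scoped RealInnerProductSpace

variable {E F : Type*} [NormedAddCommGroup E] [InnerProductSpace ℝ E]
  [NormedAddCommGroup F] [InnerProductSpace ℝ F]

/-- Both sides are bilinear and continuous, so the identity extends from generators to the closed
span, one argument at a time. -/
theorem inner_fst_eq_inner_snd_of_mem_closure_span {S : Set (E × F)}
    (hS : ∀ p ∈ S, ∀ q ∈ S, ⟪p.1, q.1⟫ = ⟪p.2, q.2⟫) {p q : E × F}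
    (hp : p ∈ (Submodule.span ℝ S).topologicalClosure)
    (hq : q ∈ (Submodule.span ℝ S).topologicalClosure) : ⟪p.1, q.1⟫ = ⟪p.2, q.2⟫ := by
  have aux : ∀ r : E × F, (∀ p ∈ S, ⟪p.1, r.1⟫ = ⟪p.2, r.2⟫) →
      ∀ p ∈ (Submodule.span ℝ S).topologicalClosure, ⟪p.1, r.1⟫ = ⟪p.2, r.2⟫ := by
    intro r hr
    refine closure_minimal (s := (Submodule.span ℝ S : Set (E × F)))
      (t := {p | ⟪p.1, r.1⟫ = ⟪p.2, r.2⟫}) (fun p hp => ?_)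
      (isClosed_eq (by fun_prop) (by fun_prop))
    induction hp using Submodule.span_induction with
    | mem x hx => exact hr x hx
    | zero => simp
    | add x y _ _ hx hy =>
      simp only [Set.mem_ofPred_eq] at hx hy
      simp [inner_add_left, hx, hy]
    | smul a x _ hx =>
      simp only [Set.mem_ofPred_eq] at hx
      simp [real_inner_smul_left, hx]
  refine aux q (fun r hr => ?_) p hp
  rw [real_inner_comm, real_inner_comm q.2]
  exact aux r (fun s hs => hS s hs r hr) q hq

/-- On the closed span both components have equal norm, which is therefore also the max norm of the
pair. The first projection is thus an isometry on a complete space, its range is closed, and it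
contains the generators. -/
theorem exists_mem_closure_span_of_fst [CompleteSpace E] [CompleteSpace F] {S : Set (E × F)}
    (hS : ∀ p ∈ S, ∀ q ∈ S, ⟪p.1, q.1⟫ = ⟪p.2, q.2⟫) {e : E}
    (he : e ∈ (Submodule.span ℝ (Prod.fst '' S)).topologicalClosure) :
    ∃ x, (e, x) ∈ (Submodule.span ℝ S).topologicalClosure := by
  set M := (Submodule.span ℝ S).topologicalClosure with hM
  have : CompleteSpace M := (Submodule.isClosed_topologicalClosure _).completeSpace_coe
  let φ : M →ₗ[ℝ] E := (LinearMap.fst ℝ E F) ∘ₗ M.subtype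
  have hφ : Isometry φ := by
    refine AddMonoidHomClass.isometry_of_norm φ fun p => ?_
    have h := inner_fst_eq_inner_snd_of_mem_closure_span hS p.2 p.2
    rw [real_inner_self_eq_norm_sq, real_inner_self_eq_norm_sq,
      sq_eq_sq₀ (norm_nonneg _) (norm_nonneg _)] at h
    show ‖(p : E × F).1‖ = ‖(p : E × F)‖
    rw [Prod.norm_def, ← h, max_self]
  have hcl : IsClosed (LinearMap.range φ : Set E) := by
    rw [LinearMap.coe_range]
    exact hφ.isClosedEmbedding.isClosed_range
  have hle : (Submodule.span ℝ (Prod.fst '' S)).topologicalClosure ≤ LinearMap.range φ := by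
    refine Submodule.topologicalClosure_minimal _ (Submodule.span_le.2 ?_) hcl
    rintro _ ⟨p, hp, rfl⟩
    exact ⟨⟨p, Submodule.le_topologicalClosure _ (Submodule.subset_span hp)⟩, rfl⟩
  obtain ⟨p, hp⟩ := hle he
  refine ⟨p.1.2, ?_⟩
  have : (e, p.1.2) = p.1 := Prod.ext hp.symm rfl
  rw [this]
  exact p.2

theorem snd_mem_closure_span {S : Set (E × F)} {p : E × F}
    (hp : p ∈ (Submodule.span ℝ S).topologicalClosure) :
    p.2 ∈ (Submodule.span ℝ (Prod.snd '' S)).topologicalClosure := by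
  refine map_mem_closure (f := Prod.snd) continuous_snd hp fun q hq => ?_
  have := Submodule.mem_map_of_mem (f := LinearMap.snd ℝ E F) hq
  rwa [Submodule.map_span] at this

end HilbertGraph

/-! ### The Wiener integral as a closed graph -/

section WienerIntegral

variable {T : ℝ}

instance isFiniteMeasure_volume_timeInterval :
    IsFiniteMeasure (volume : Measure (TimeInterval T)) := by
  constructor
  show (volume : Measure ℝ).comap Subtype.val Set.univ < ⊤
  rw [comap_subtype_coe_apply measurableSet_Icc, Set.image_univ, Subtype.range_coe]
  exact measure_Icc_lt_top

theorem volume_real_Iio (t : TimeInterval T) :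
    (volume : Measure (TimeInterval T)).real (Set.Iio t) = t := by
  have h : (volume : Measure (TimeInterval T)) (Set.Iio t) = ENNReal.ofReal t := by
    show (volume : Measure ℝ).comap Subtype.val (Set.Iio t) = _
    rw [comap_subtype_coe_apply measurableSet_Icc]
    have : Subtype.val '' (Set.Iio t) = Set.Ico (0 : ℝ) t := by
      ext x
      constructor
      · rintro ⟨y, hy, rfl⟩
        exact ⟨y.2.1, hy⟩
      · rintro ⟨h0, h1⟩
        exact ⟨⟨x, h0, h1.le.trans t.2.2⟩, h1, rfl⟩
    rw [this, Real.volume_Ico, sub_zero]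
  rw [Measure.real, h, ENNReal.toReal_ofReal t.2.1]

/-- The class in `L²([0,T])` of the indicator of `[0,t)`. -/
def indicatorIioLp (t : TimeInterval T) : Lp ℝ 2 (volume : Measure (TimeInterval T)) :=
  indicatorConstLp 2 measurableSet_Iio (measure_ne_top _ (Set.Iio t)) 1

open scoped RealInnerProductSpace in
theorem inner_indicatorIioLp (s t : TimeInterval T) :
    ⟪indicatorIioLp s, indicatorIioLp t⟫ = min (s : ℝ) t := by
  rw [indicatorIioLp, indicatorIioLp, L2.real_inner_indicatorConstLp_one_indicatorConstLp_one]
  rw [Set.Iio_inter_Iio, volume_real_Iio]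
  simp

variable {Ω : Type*} [MeasurableSpace Ω] {P : Measure Ω}

theorem IsBrownianMotionOn.memLp {W : TimeInterval T → Ω → ℝ} (hW : IsBrownianMotionOn P W)
    (t : TimeInterval T) : MemLp (W t) 2 P :=
  (hW.gaussian.hasGaussianLaw_eval t).memLp_two

/-- The pairs `(1_[0,t), Wₜ)` in `L²([0,T]) × L²(Ω)`. -/
def IsBrownianMotionOn.pair {W : TimeInterval T → Ω → ℝ} (hW : IsBrownianMotionOn P W)
    (t : TimeInterval T) : Lp ℝ 2 (volume : Measure (TimeInterval T)) × Lp ℝ 2 P :=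
  (indicatorIioLp t, (hW.memLp t).toLp)

-- The Itô isometry on generators: both inner products equal min(s, t).
open scoped RealInnerProductSpace in
theorem IsBrownianMotionOn.inner_pair [IsProbabilityMeasure P]
    {W : TimeInterval T → Ω → ℝ} (hW : IsBrownianMotionOn P W) :
    ∀ p ∈ Set.range hW.pair, ∀ q ∈ Set.range hW.pair, ⟪p.1, q.1⟫ = ⟪p.2, q.2⟫ := by
  rintro _ ⟨s, rfl⟩ _ ⟨t, rfl⟩
  simp only [IsBrownianMotionOn.pair]
  rw [inner_indicatorIioLp, ← hW.covariance s t,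
    covariance_eq_sub (hW.memLp s) (hW.memLp t), hW.centered s, zero_mul, sub_zero, L2.inner_def]
  refine integral_congr_ae ?_
  filter_upwards [(hW.memLp s).coeFn_toLp, (hW.memLp t).coeFn_toLp] with ω h1 h2
  simp [h1, h2, mul_comm]

theorem coeFn_sum_indicatorIioLp (c : TimeInterval T →₀ ℝ) :
    (c.sum fun t a => a • indicatorIioLp t : Lp ℝ 2 (volume : Measure (TimeInterval T)))
      =ᵐ[volume] stepFunction c := by
  have h1 : ∀ᵐ s, ∀ t ∈ c.support,
      (c t • indicatorIioLp t : Lp ℝ 2 (volume : Measure (TimeInterval T))) s =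
        c t * (Set.Iio t).indicator 1 s := by
    refine (ae_ball_iff c.support.countable_toSet).2 fun t _ => ?_
    filter_upwards [Lp.coeFn_smul (c t) (indicatorIioLp t),
      indicatorConstLp_coeFn (p := 2) (hs := measurableSet_Iio)
        (hμs := measure_ne_top volume (Set.Iio t)) (c := (1 : ℝ))] with s h1 h2
    rw [h1, Pi.smul_apply, indicatorIioLp, h2, smul_eq_mul]
    rfl
  filter_upwards [h1, Lp.coeFn_finsetSum c.support fun t => c t • indicatorIioLp t] with s h1 h2
  rw [Finsupp.sum, h2, Finset.sum_apply]
  exact Finset.sum_congr rfl fun i hi => h1 i hi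

theorem IsBrownianMotionOn.coeFn_sum {W : TimeInterval T → Ω → ℝ} (hW : IsBrownianMotionOn P W)
    (c : TimeInterval T →₀ ℝ) :
    (c.sum fun t a => a • (hW.memLp t).toLp : Lp ℝ 2 P) =ᵐ[P] elementaryIntegral W c := by
  have h1 : ∀ᵐ ω ∂P, ∀ t ∈ c.support,
      (c t • (hW.memLp t).toLp : Lp ℝ 2 P) ω = c t * W t ω := by
    refine (ae_ball_iff c.support.countable_toSet).2 fun t _ => ?_
    filter_upwards [Lp.coeFn_smul (c t) (hW.memLp t).toLp, (hW.memLp t).coeFn_toLp] with s h1 h2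
    rw [h1, Pi.smul_apply, h2, smul_eq_mul]
  filter_upwards [h1, Lp.coeFn_finsetSum c.support fun t => c t • (hW.memLp t).toLp] with s h1 h2
  rw [Finsupp.sum, h2, Finset.sum_apply]
  exact Finset.sum_congr rfl fun i hi => h1 i hi

/-- Wiener integration is the closure of the graph of `1_[0,t) ↦ Wₜ`. -/
theorem isWienerIntegral_iff {W : TimeInterval T → Ω → ℝ} (hW : IsBrownianMotionOn P W)
    {f : TimeInterval T → ℝ} {ξ : Ω → ℝ} (hf : MemLp f 2 volume) (hξ : MemLp ξ 2 P) :
    IsWienerIntegral P W f ξ ↔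
      (hf.toLp, hξ.toLp) ∈ (Submodule.span ℝ (Set.range hW.pair)).topologicalClosure := by
  let A (c : TimeInterval T →₀ ℝ) : Lp ℝ 2 (volume : Measure (TimeInterval T)) :=
    c.sum fun t a => a • indicatorIioLp t
  let B (c : TimeInterval T →₀ ℝ) : Lp ℝ 2 P := c.sum fun t a => a • (hW.memLp t).toLp
  have hspan : ∀ p, p ∈ Submodule.span ℝ (Set.range hW.pair) ↔ ∃ c, (A c, B c) = p := by
    intro p
    rw [Finsupp.mem_span_range_iff_exists_finsupp]
    refine exists_congr fun c => ?_
    have : (c.sum fun t a => a • hW.pair t) = (A c, B c) := by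
      refine Prod.ext ?_ ?_
      · simp [A, Finsupp.sum, Prod.fst_sum, IsBrownianMotionOn.pair]
      · simp [B, Finsupp.sum, Prod.snd_sum, IsBrownianMotionOn.pair]
    rw [this]
  have h1 : ∀ c : ℕ → TimeInterval T →₀ ℝ,
      Tendsto (fun n => eLpNorm (f - stepFunction (c n)) 2 volume) atTop (𝓝 0) ↔
        Tendsto (fun n => A (c n)) atTop (𝓝 hf.toLp) := by
    intro c
    rw [Lp.tendsto_Lp_iff_tendsto_eLpNorm' _ _]
    refine tendsto_congr fun n => ?_
    -- The definition subtracts the approximant from the limit, the `Lp` criterion the limit from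
    -- the approximant.
    rw [← eLpNorm_neg]
    refine eLpNorm_congr_ae ?_
    filter_upwards [coeFn_sum_indicatorIioLp (c n), hf.coeFn_toLp] with s h1 h2
    simp [A, h1, h2]
  have h2 : ∀ c : ℕ → TimeInterval T →₀ ℝ,
      Tendsto (fun n => eLpNorm (ξ - elementaryIntegral W (c n)) 2 P) atTop (𝓝 0) ↔
        Tendsto (fun n => B (c n)) atTop (𝓝 hξ.toLp) := by
    intro c
    rw [Lp.tendsto_Lp_iff_tendsto_eLpNorm' _ _]
    refine tendsto_congr fun n => ?_
    rw [← eLpNorm_neg]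
    refine eLpNorm_congr_ae ?_
    filter_upwards [hW.coeFn_sum (c n), hξ.coeFn_toLp] with s h1 h2
    simp [B, h1, h2]
  rw [← SetLike.mem_coe, Submodule.topologicalClosure_coe, mem_closure_iff_seq_limit]
  constructor
  · rintro ⟨-, -, c, hc1, hc2⟩
    exact ⟨fun n => (A (c n), B (c n)), fun n => (hspan _).2 ⟨c n, rfl⟩,
      ((h1 c).1 hc1).prodMk_nhds ((h2 c).1 hc2)⟩
  · rintro ⟨p, hp, hlim⟩
    choose c hc using fun n => (hspan (p n)).1 (hp n)
    obtain rfl : (fun n => (A (c n), B (c n))) = p := funext hc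
    rw [nhds_prod_eq, tendsto_prod_iff'] at hlim
    exact ⟨hf, hξ, c, (h1 c).2 hlim.1, (h2 c).2 hlim.2⟩

end WienerIntegral

/-! ### Freezing an independent variable, translated laws, equality of kernels -/

section ShiftKernel

variable {Ω Ω' β γ ι : Type*} [MeasurableSpace Ω] [MeasurableSpace Ω'] [MeasurableSpace β]
  [MeasurableSpace γ]

/-- Independence makes the joint law of (Z, Y) a product, and Tonelli allows Z to be frozen while Y
is integrated out. -/
theorem ProbabilityTheory.IndepFun.setLIntegral_map_preimage {P : Measure Ω}
    [IsProbabilityMeasure P]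
    {Z : Ω → Ω'} {Y : Ω → β} (hZ : Measurable Z) (hY : Measurable Y) (h : IndepFun Z Y P)
    {Φ : Ω' × β → γ} (hΦ : Measurable Φ) {A : Set γ} (hA : MeasurableSet A) {B : Set Ω'}
    (hB : MeasurableSet B) :
    ∫⁻ ω in Z ⁻¹' B, (P.map Y) {y | Φ (Z ω, y) ∈ A} ∂P =
      P (Z ⁻¹' B ∩ {ω | Φ (Z ω, Y ω) ∈ A}) := by
  have hS : MeasurableSet (B ×ˢ Set.univ ∩ Φ ⁻¹' A) :=
    (hB.prod MeasurableSet.univ).inter (hΦ hA)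
  have : IsProbabilityMeasure (P.map Y) := Measure.isProbabilityMeasure_map hY.aemeasurable
  have h1 : P (Z ⁻¹' B ∩ {ω | Φ (Z ω, Y ω) ∈ A}) =
      P.map (fun ω => (Z ω, Y ω)) (B ×ˢ Set.univ ∩ Φ ⁻¹' A) := by
    rw [Measure.map_apply (hZ.prodMk hY) hS]
    congr 1
    ext ω
    simp
  have hmeas : Measurable fun z => (P.map Y) {y | Φ (z, y) ∈ A} :=
    measurable_measure_prodMk_left (hΦ hA)
  rw [h1, h.map_prod_eq_prod_map_map hZ.aemeasurable hY.aemeasurable, Measure.prod_apply hS,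
    ← setLIntegral_map hB hmeas hZ, ← lintegral_indicator hB]
  refine lintegral_congr fun z => ?_
  by_cases hz : z ∈ B
  · rw [Set.indicator_of_mem hz]
    congr 1
    ext y
    simp [hz]
  · rw [Set.indicator_of_notMem hz]
    symm
    convert measure_empty (μ := P.map Y)
    ext y
    simp [hz]

/-- The kernel sending `z` to the law `ν` translated by `M z`. -/
def shiftKernel (M : Ω' → ι → ℝ) (hM : Measurable M) (ν : Measure (ι → ℝ)) [SFinite ν] :
    Kernel Ω' (ι → ℝ) where
  toFun z := ν.map fun y => M z + y
  measurable' := by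
    refine Measure.measurable_of_measurable_coe _ fun A hA => ?_
    have hadd : ∀ z, Measurable fun y : ι → ℝ => M z + y := fun z => by fun_prop
    have hΦ : Measurable fun p : Ω' × (ι → ℝ) => M p.1 + p.2 := by fun_prop
    simp_rw [fun z => Measure.map_apply (μ := ν) (hadd z) hA]
    exact measurable_measure_prodMk_left (hΦ hA)

theorem shiftKernel_apply (M : Ω' → ι → ℝ) (hM : Measurable M) (ν : Measure (ι → ℝ)) [SFinite ν]
    (z : Ω') : shiftKernel M hM ν z = ν.map fun y => M z + y := rfl

end ShiftKernel

/-- The null set in the hypothesis may depend on A. Passing to the composition-product, determined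
by rectangles, removes this dependence; the countability assumption is what recovers the kernel from
it. -/
theorem ProbabilityTheory.Kernel.ae_eq_of_forall_measurableSet {α β : Type*} [MeasurableSpace α]
    [MeasurableSpace β] [MeasurableSpace.CountableOrCountablyGenerated α β] {μ : Measure α}
    [IsFiniteMeasure μ] {κ η : Kernel α β} [IsFiniteKernel κ] [IsFiniteKernel η]
    (h : ∀ A, MeasurableSet A → ∀ᵐ a ∂μ, κ a A = η a A) : κ =ᵐ[μ] η := by
  refine Kernel.ae_eq_of_compProd_eq (Measure.ext_prod fun {s t} hs ht => ?_)
  rw [Measure.compProd_apply_prod hs ht, Measure.compProd_apply_prod hs ht]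
  exact lintegral_congr_ae (ae_restrict_of_ae (h t ht))

/-! ### Existence and uniqueness of the regular conditional law -/

section RegularCondLaw

variable {T : ℝ} {Ω : Type*} {m : MeasurableSpace Ω} [mΩ : MeasurableSpace Ω] {P : Measure Ω}
  [IsProbabilityMeasure P] {X : TimeInterval T → Ω → ℝ}

/-- Given m, the part M is known and Y keeps its unconditional law, so only a translation by M
remains. -/
theorem isRegularCondLaw_shiftKernel (hm : m ≤ mΩ) {M Y : Ω → TimeInterval T → ℝ}
    (hM : Measurable[m] M) (hY : Measurable Y)
    (hind : Indep m (MeasurableSpace.comap Y MeasurableSpace.pi) P)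
    (hX : ∀ t ω, X t ω = M ω t + Y ω t) :
    IsRegularCondLaw P X m (@shiftKernel Ω (TimeInterval T) m M hM (P.map Y) _) := by
  have hadd : ∀ ω, Measurable fun y : TimeInterval T → ℝ => M ω + y := fun ω => by fun_prop
  have : IsProbabilityMeasure (P.map Y) := Measure.isProbabilityMeasure_map hY.aemeasurable
  have hprob : ∀ ω, IsProbabilityMeasure (@shiftKernel Ω (TimeInterval T) m M hM (P.map Y) _ ω) :=
    fun ω => Measure.isProbabilityMeasure_map (hadd ω).aemeasurable
  refine ⟨hprob, fun A hA => ?_⟩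
  set κ := @shiftKernel Ω (TimeInterval T) m M hM (P.map Y) _ with hκ
  have hXm : Measurable fun ω t => X t ω := by
    have : (fun ω t => X t ω) = fun ω => M ω + Y ω := by
      ext ω t
      exact hX t ω
    rw [this]
    exact (hM.mono hm le_rfl).add hY
  have hXA : MeasurableSet {ω | (fun t => X t ω) ∈ A} := hXm hA
  have hκm : Measurable[m] fun ω => κ ω A := Kernel.measurable_coe κ hA
  have hκm' : Measurable[m] fun ω => (κ ω).real A := hκm.ennreal_toReal
  have hκi : Integrable (fun ω => (κ ω).real A) P :=
    Integrable.of_bound (C := 1) (hκm'.mono hm le_rfl).aestronglyMeasurable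
      (ae_of_all _ fun ω => by
        have := hprob ω
        rw [Real.norm_of_nonneg measureReal_nonneg]
        exact measureReal_le_one)
  refine ae_eq_condExp_of_forall_setIntegral_eq hm
    ((integrable_const (1 : ℝ)).indicator hXA) (fun _ _ _ => hκi.integrableOn) (fun B hB _ => ?_)
    hκm'.stronglyMeasurable.aestronglyMeasurable
  have key : ∫⁻ ω in B, κ ω A ∂P = P (B ∩ {ω | (fun t => X t ω) ∈ A}) := by
    have hΦ : @Measurable _ _ (@Prod.instMeasurableSpace _ _ m _) _
        fun p : Ω × (TimeInterval T → ℝ) => M p.1 + p.2 :=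
      (hM.comp (@measurable_fst _ _ m _)).add (@measurable_snd _ _ m _)
    -- Freezing is applied to the identity from Ω with its full σ-algebra to Ω with m, whose
    -- generated σ-algebra is m itself.
    have h := @IndepFun.setLIntegral_map_preimage Ω Ω (TimeInterval T → ℝ) (TimeInterval T → ℝ)
      mΩ m _ _ P _ id Y (measurable_id'' hm) hY
      ((@IndepFun_iff_Indep _ _ _ _ m _ _ _ _).2 (by rwa [MeasurableSpace.comap_id])) _ hΦ A hA B hB
    have hset : {ω | (fun t => X t ω) ∈ A} = {ω | M ω + Y ω ∈ A} := by
      ext ω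
      have : (fun t => X t ω) = M ω + Y ω := funext fun t => hX t ω
      rw [Set.mem_ofPred_eq, Set.mem_ofPred_eq, this]
    rw [hset]
    refine Eq.trans (lintegral_congr fun ω => ?_) h
    exact Measure.map_apply (hadd ω) hA
  rw [setIntegral_indicator hXA, setIntegral_const, smul_eq_mul, mul_one, Measure.real, ← key,
    ← integral_toReal (hκm.mono hm le_rfl).aemeasurable
      (ae_of_all _ fun ω => by have := hprob ω; exact measure_lt_top _ _)]
  rfl

theorem IsRegularCondLaw.ae_map_restrict_eq (hm : m ≤ mΩ)
    {κ κ' : @Kernel Ω (TimeInterval T → ℝ) m MeasurableSpace.pi}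
    (h : IsRegularCondLaw P X m κ) (h' : IsRegularCondLaw P X m κ')
    (J : Finset (TimeInterval T)) :
    ∀ᵐ ω ∂P, (κ' ω).map J.restrict = (κ ω).map J.restrict := by
  have hJ : Measurable (J.restrict : (TimeInterval T → ℝ) → J → ℝ) := by fun_prop
  have i1 : @IsMarkovKernel _ _ m _ κ := @IsMarkovKernel.mk _ _ m _ κ h.isProbabilityMeasure
  have i2 : @IsMarkovKernel _ _ m _ κ' := @IsMarkovKernel.mk _ _ m _ κ' h'.isProbabilityMeasure
  have i3 := Kernel.IsMarkovKernel.map κ hJ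
  have i4 := Kernel.IsMarkovKernel.map κ' hJ
  -- The kernels are only m-measurable in ω, so they are compared under the restriction of P to m.
  have i5 : IsFiniteMeasure (P.trim hm) := isFiniteMeasure_trim hm
  have key : κ'.map J.restrict =ᵐ[P.trim hm]
      κ.map J.restrict := by
    refine @Kernel.ae_eq_of_forall_measurableSet _ _ m _ _ _ i5 _ _ inferInstance inferInstance
      fun A hA => ?_
    have hA' := hJ hA
    have hme : ∀ η : @Kernel Ω (TimeInterval T → ℝ) m MeasurableSpace.pi,
        Measurable[m] fun ω => η ω (J.restrict ⁻¹' A) := fun η => Kernel.measurable_coe η hA'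
    have hae : (fun ω => κ' ω (J.restrict ⁻¹' A)) =ᵐ[P.trim hm]
        fun ω => κ ω (J.restrict ⁻¹' A) := by
      refine ae_eq_trim_of_measurable hm (hme κ') (hme κ) ?_
      filter_upwards [(h'.condProb _ hA').trans (h.condProb _ hA').symm] with ω hω
      have := h.isProbabilityMeasure ω
      have := h'.isProbabilityMeasure ω
      exact (ENNReal.toReal_eq_toReal_iff' (measure_ne_top _ _) (measure_ne_top _ _)).1 hω
    filter_upwards [hae] with ω hω
    rw [Kernel.map_apply' _ hJ ω hA, Kernel.map_apply' _ hJ ω hA]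
    exact hω
  filter_upwards [ae_of_ae_trim hm key] with ω hω
  rwa [Kernel.map_apply _ hJ, Kernel.map_apply _ hJ] at hω

end RegularCondLaw

/-! ### Projection, prediction error and conditional expectation -/

section Prediction

open scoped RealInnerProductSpace

theorem MeasureTheory.MemLp.inner_toLp_eq_integral_mul {α : Type*} [MeasurableSpace α]
    {μ : Measure α} {f g : α → ℝ} (hf : MemLp f 2 μ) (hg : MemLp g 2 μ) :
    ⟪hf.toLp, hg.toLp⟫ = ∫ a, f a * g a ∂μ := by
  rw [L2.inner_def]
  refine integral_congr_ae ?_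
  filter_upwards [hf.coeFn_toLp, hg.coeFn_toLp] with a h1 h2
  simp [h1, h2, mul_comm]

theorem observedSigma_eq_comap {T : ℝ} {Ω : Type*} (X : TimeInterval T → Ω → ℝ)
    (Δ : Set (TimeInterval T)) :
    observedSigma X Δ = MeasurableSpace.comap (fun ω (u : Δ) => X u ω) MeasurableSpace.pi := by
  rw [MeasurableSpace.pi, MeasurableSpace.comap_iSup, observedSigma, iSup_subtype']
  simp_rw [MeasurableSpace.comap_comp]
  rfl

namespace HasFredholmRepresentation

variable {T : ℝ} {Ω : Type*} [mΩ : MeasurableSpace Ω] {P : Measure Ω}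
  {X : TimeInterval T → Ω → ℝ} {K : TimeInterval T → TimeInterval T → ℝ}
  {W : TimeInterval T → Ω → ℝ} (hX : HasFredholmRepresentation P X K W)
  (Δ : Set (TimeInterval T))

theorem observedSigma_le (hX : HasFredholmRepresentation P X K W) (Δ : Set (TimeInterval T)) :
    observedSigma X Δ ≤ mΩ :=
  iSup₂_le fun t _ => (hX.measurable t).comap_le

/-- The class of `K(t,·)` in `L²([0,T])`. -/
def kernelLp (t : TimeInterval T) : Lp ℝ 2 (volume : Measure (TimeInterval T)) :=
  (hX.fredholm t).1.toLp

/-- The class of `Xₜ` in `L²(Ω)`. -/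
def processLp (t : TimeInterval T) : Lp ℝ 2 P := (hX.fredholm t).2.1.toLp

theorem coeFn_processLp (t : TimeInterval T) : hX.processLp t =ᵐ[P] X t := MemLp.coeFn_toLp _

/-- The pair `(K(t,·), Xₜ)` in `L²([0,T]) × L²(Ω)`. -/
def pair (t : TimeInterval T) : Lp ℝ 2 (volume : Measure (TimeInterval T)) × Lp ℝ 2 P :=
  (hX.kernelLp t, hX.processLp t)

theorem pair_mem (t : TimeInterval T) :
    hX.pair t ∈ (Submodule.span ℝ (Set.range hX.brownian.pair)).topologicalClosure :=
  (isWienerIntegral_iff hX.brownian _ _).1 (hX.fredholm t)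

theorem processLp_mem (t : TimeInterval T) :
    hX.processLp t ∈ (Submodule.span ℝ (Set.range hX.processLp)).topologicalClosure :=
  Submodule.le_topologicalClosure _ (Submodule.subset_span ⟨t, rfl⟩)

theorem closure_span_pair_le :
    (Submodule.span ℝ (hX.pair '' Δ)).topologicalClosure ≤
      (Submodule.span ℝ (Set.range hX.brownian.pair)).topologicalClosure := by
  refine Submodule.topologicalClosure_minimal _ (Submodule.span_le.2 ?_)
    (Submodule.isClosed_topologicalClosure _)
  rintro _ ⟨t, -, rfl⟩
  exact hX.pair_mem t

/-- The orthogonal projection of K(t,·) to the closed span of the K(u,·), u ∈ Δ, lifts to a pair in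
the graph because the first projection maps onto that closed span. -/
theorem exists_predictor [IsProbabilityMeasure P] (t : TimeInterval T) :
    ∃ p ∈ (Submodule.span ℝ (hX.pair '' Δ)).topologicalClosure,
      ∀ u ∈ Δ, ⟪hX.kernelLp t - p.1, hX.kernelLp u⟫ = 0 := by
  set V := (Submodule.span ℝ (Prod.fst '' (hX.pair '' Δ))).topologicalClosure with hV
  have : CompleteSpace V := (Submodule.isClosed_topologicalClosure _).completeSpace_coe
  obtain ⟨ξ, hξ⟩ := exists_mem_closure_span_of_fst (S := hX.pair '' Δ)
    (e := (V.starProjection (hX.kernelLp t))) (by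
      rintro _ ⟨s, -, rfl⟩ _ ⟨u, -, rfl⟩
      exact inner_fst_eq_inner_snd_of_mem_closure_span hX.brownian.inner_pair
        (hX.pair_mem s) (hX.pair_mem u)) (Submodule.starProjection_apply_mem _ _)
  refine ⟨_, hξ, fun u hu => ?_⟩
  refine V.starProjection_inner_eq_zero _ _ ?_
  exact Submodule.le_topologicalClosure _ (Submodule.subset_span ⟨_, ⟨u, hu, rfl⟩, rfl⟩)

variable [IsProbabilityMeasure P]

/-- The projection of `(K(t,·), Xₜ)` to the closed span of the `(K(u,·), Xᵤ)`, `u ∈ Δ`. -/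
def predictor (t : TimeInterval T) : Lp ℝ 2 (volume : Measure (TimeInterval T)) × Lp ℝ 2 P :=
  (hX.exists_predictor Δ t).choose

theorem predictor_mem (t : TimeInterval T) :
    hX.predictor Δ t ∈ (Submodule.span ℝ (hX.pair '' Δ)).topologicalClosure :=
  (hX.exists_predictor Δ t).choose_spec.1

theorem inner_kernelLp_sub_predictor (t : TimeInterval T) {u : TimeInterval T} (hu : u ∈ Δ) :
    ⟪hX.kernelLp t - (hX.predictor Δ t).1, hX.kernelLp u⟫ = 0 :=
  (hX.exists_predictor Δ t).choose_spec.2 u hu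

theorem sub_predictor_mem (t : TimeInterval T) : hX.pair t - hX.predictor Δ t ∈
    (Submodule.span ℝ (Set.range hX.brownian.pair)).topologicalClosure :=
  Submodule.sub_mem _ (hX.pair_mem t) (hX.closure_span_pair_le Δ (hX.predictor_mem Δ t))

/-- The isometry carries the orthogonality of kernels to that of random variables. -/
theorem inner_processLp_sub_predictor (t : TimeInterval T) {u : TimeInterval T} (hu : u ∈ Δ) :
    ⟪hX.processLp t - (hX.predictor Δ t).2, hX.processLp u⟫ = 0 := by
  rw [← hX.inner_kernelLp_sub_predictor Δ t hu]
  exact (inner_fst_eq_inner_snd_of_mem_closure_span hX.brownian.inner_pair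
    (hX.sub_predictor_mem Δ t) (hX.pair_mem u)).symm

theorem predictor_fst_inner_eq_zero (t : TimeInterval T)
    {h : Lp ℝ 2 (volume : Measure (TimeInterval T))}
    (hh : ∀ u ∈ Δ, ⟪hX.kernelLp u, h⟫ = 0) : ⟪(hX.predictor Δ t).1, h⟫ = 0 := by
  have : hX.predictor Δ t ∈ LinearMap.ker ((innerSL ℝ h).comp (ContinuousLinearMap.fst ℝ
      (Lp ℝ 2 (volume : Measure (TimeInterval T))) (Lp ℝ 2 P))).toLinearMap := by
    refine Submodule.topologicalClosure_minimal _ (Submodule.span_le.2 ?_)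
      (ContinuousLinearMap.isClosed_ker ((innerSL ℝ h).comp (ContinuousLinearMap.fst ℝ
      (Lp ℝ 2 (volume : Measure (TimeInterval T))) (Lp ℝ 2 P)))) (hX.predictor_mem Δ t)
    rintro _ ⟨u, hu, rfl⟩
    rw [SetLike.mem_coe, LinearMap.mem_ker]
    simpa [pair, real_inner_comm] using hh u hu
  rw [real_inner_comm]
  exact this

theorem isPredictionKernel_predictor (t : TimeInterval T) :
    IsPredictionKernel K Δ t (hX.predictor Δ t).1 where
  memLp := Lp.memLp _
  system u hu := by
    rw [← (hX.fredholm t).1.inner_toLp_eq_integral_mul (hX.fredholm u).1,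
      ← (Lp.memLp (hX.predictor Δ t).1).inner_toLp_eq_integral_mul (hX.fredholm u).1,
      Lp.toLp_coeFn]
    have h := hX.inner_kernelLp_sub_predictor Δ t hu
    rw [inner_sub_left, sub_eq_zero] at h
    exact h.symm
  orthogonal h hh h0 := by
    rw [← (Lp.memLp (hX.predictor Δ t).1).inner_toLp_eq_integral_mul hh, Lp.toLp_coeFn]
    refine hX.predictor_fst_inner_eq_zero Δ t fun u hu => ?_
    rw [real_inner_comm, ← h0 u hu]
    exact hh.inner_toLp_eq_integral_mul _

/-- The difference d of two solutions is orthogonal to every K(u,·) by the system, so by the second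
condition each solution is orthogonal to d. Hence d is orthogonal to itself. -/
theorem eq_predictor_of_isPredictionKernel (t : TimeInterval T) {g : TimeInterval T → ℝ}
    (hg : IsPredictionKernel K Δ t g) : g =ᵐ[volume] (hX.predictor Δ t).1 := by
  set d := hg.memLp.toLp - (hX.predictor Δ t).1 with hd
  have hdK : ∀ u ∈ Δ, ⟪d, hX.kernelLp u⟫ = 0 := by
    intro u hu
    have h1 : ⟪hg.memLp.toLp, hX.kernelLp u⟫ = ⟪hX.kernelLp t, hX.kernelLp u⟫ := by
      rw [kernelLp, kernelLp, MemLp.inner_toLp_eq_integral_mul, MemLp.inner_toLp_eq_integral_mul,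
        hg.system u hu]
    have h2 := hX.inner_kernelLp_sub_predictor Δ t hu
    rw [inner_sub_left] at h2
    rw [hd, inner_sub_left, h1, h2]
  have h1 : ⟪hg.memLp.toLp, d⟫ = 0 := by
    have := hg.orthogonal d (Lp.memLp d) fun u hu => by
      rw [← (Lp.memLp d).inner_toLp_eq_integral_mul (hX.fredholm u).1, Lp.toLp_coeFn]
      exact hdK u hu
    rwa [← hg.memLp.inner_toLp_eq_integral_mul (Lp.memLp d), Lp.toLp_coeFn] at this
  have h2 : ⟪(hX.predictor Δ t).1, d⟫ = 0 :=
    hX.predictor_fst_inner_eq_zero Δ t fun u hu => by rw [real_inner_comm, hdK u hu]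
  have h3 : d = 0 := by
    rw [← inner_self_eq_zero (𝕜 := ℝ)]
    nth_rewrite 1 [hd]
    rw [inner_sub_left, h1, h2, sub_zero]
  rw [sub_eq_zero] at h3
  rw [← h3]
  exact hg.memLp.coeFn_toLp.symm

theorem map_eq_gaussianReal {ξ : Lp ℝ 2 P}
    (hξ : ξ ∈ (Submodule.span ℝ (Set.range hX.processLp)).topologicalClosure) :
    P.map ξ = gaussianReal 0 (‖ξ‖ ^ 2).toNNReal :=
  map_eq_gaussianReal_of_mem_closure_span hX.gaussian hX.centered hX.processLp hX.coeFn_processLp hξ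

theorem integral_eq_zero {ξ : Lp ℝ 2 P}
    (hξ : ξ ∈ (Submodule.span ℝ (Set.range hX.processLp)).topologicalClosure) :
    ∫ ω, ξ ω ∂P = 0 := by
  have h : ∫ x, x ∂(P.map ξ) = 0 := by
    rw [hX.map_eq_gaussianReal hξ]
    exact integral_id_gaussianReal
  rwa [integral_map (f := fun x : ℝ => x) (Lp.aestronglyMeasurable ξ).aemeasurable
    aestronglyMeasurable_id] at h

theorem covariance_eq_inner {ξ η : Lp ℝ 2 P}
    (hξ : ξ ∈ (Submodule.span ℝ (Set.range hX.processLp)).topologicalClosure)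
    {Z Z' : Ω → ℝ} (hZ : Z =ᵐ[P] ξ) (hZ' : Z' =ᵐ[P] η) : cov[Z, Z'; P] = ⟪ξ, η⟫ := by
  have hm := (memLp_congr_ae hZ).2 (Lp.memLp ξ)
  have hm' := (memLp_congr_ae hZ').2 (Lp.memLp η)
  rw [covariance_eq_sub hm hm', integral_congr_ae hZ, hX.integral_eq_zero hξ, zero_mul, sub_zero,
    L2.inner_def]
  refine integral_congr_ae ?_
  filter_upwards [hZ, hZ'] with ω h1 h2
  simp [h1, h2, mul_comm]

theorem predictor_snd_mem_image (t : TimeInterval T) : (hX.predictor Δ t).2 ∈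
    (Submodule.span ℝ (hX.processLp '' Δ)).topologicalClosure := by
  have h := snd_mem_closure_span (hX.predictor_mem Δ t)
  rwa [Set.image_image] at h

/-- The prediction error `Xₜ - X̂ₜ` in `L²(Ω)`. -/
def errorLp (t : TimeInterval T) : Lp ℝ 2 P := hX.processLp t - (hX.predictor Δ t).2

theorem errorLp_mem (t : TimeInterval T) :
    hX.errorLp Δ t ∈ (Submodule.span ℝ (Set.range hX.processLp)).topologicalClosure :=
  Submodule.sub_mem _ (hX.processLp_mem t) <|
    Submodule.topologicalClosure_mono (Submodule.span_mono (Set.image_subset_range _ _))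
      (hX.predictor_snd_mem_image Δ t)

/-- Observations and errors lie in one space of centered Gaussian variables, hence are jointly
Gaussian, and their covariances vanish. The free index map τ covers both a single error and the
whole error process, with arbitrary versions Z. -/
theorem indep_observedSigma {ι : Type*} {Z : ι → Ω → ℝ} (τ : ι → TimeInterval T)
    (hZ : ∀ i, Z i =ᵐ[P] hX.errorLp Δ (τ i)) :
    Indep (observedSigma X Δ) (MeasurableSpace.comap (fun ω i => Z i ω) MeasurableSpace.pi) P := by
  have hgauss : IsGaussianProcess (Sum.elim (fun u : Δ => X u) Z) P := by
    refine isGaussianProcess_of_forall_mem _ (fun ξ hξ => hX.map_eq_gaussianReal hξ) _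
      (Sum.elim (fun u : Δ => hX.processLp u) fun i => hX.errorLp Δ (τ i)) ?_ ?_
    · rintro (u | i)
      · exact hX.processLp_mem u
      · exact hX.errorLp_mem Δ (τ i)
    · rintro (u | i)
      · exact (hX.coeFn_processLp u).symm
      · exact hZ i
  have h : IndepFun (fun ω (u : Δ) => X u ω) (fun ω i => Z i ω) P := by
    refine hgauss.indepFun_of_covariance_eq_zero (fun u => (hX.measurable u).aemeasurable)
      (fun i => (Lp.aestronglyMeasurable _).aemeasurable.congr (hZ i).symm) fun u i => ?_
    rw [hX.covariance_eq_inner (hX.processLp_mem u) (hX.coeFn_processLp u).symm (hZ i),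
      real_inner_comm]
    exact hX.inner_processLp_sub_predictor Δ (τ i) u.2
  rw [observedSigma_eq_comap]
  exact (IndepFun_iff_Indep _ _ _).1 h

/-- Xₜ splits into predictor and error. The predictor is an L² limit of combinations of
observations, so conditioning fixes it; the error is independent of them and centered, so
conditioning kills it. -/
theorem condExp_eq_predictor (t : TimeInterval T) :
    P[X t | observedSigma X Δ] =ᵐ[P] (hX.predictor Δ t).2 := by
  have hm := hX.observedSigma_le Δ
  have h1 : X t =ᵐ[P] ((hX.predictor Δ t).2 + hX.errorLp Δ t : Ω → ℝ) := by
    filter_upwards [hX.coeFn_processLp t, Lp.coeFn_sub (hX.processLp t) (hX.predictor Δ t).2]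
      with ω h1 h2
    rw [Pi.add_apply, errorLp, h2, Pi.sub_apply, h1]
    ring
  have hi : ∀ ξ : Lp ℝ 2 P, Integrable ξ P := fun ξ => (Lp.memLp ξ).integrable (by norm_num)
  have h2 : P[(hX.errorLp Δ t : Ω → ℝ) | observedSigma X Δ] =ᵐ[P] fun _ => 0 := by
    -- A single error is treated as a family indexed by one point.
    have hind := hX.indep_observedSigma Δ (Z := fun _ : Unit => hX.errorLp Δ t) (fun _ => t)
      fun _ => .rfl
    have hle : MeasurableSpace.comap (hX.errorLp Δ t : Ω → ℝ) inferInstance ≤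
        MeasurableSpace.comap (fun ω (_ : Unit) => hX.errorLp Δ t ω) MeasurableSpace.pi := by
      have hc := (measurable_pi_apply (X := fun _ : Unit => ℝ) ()).comp
        (comap_measurable (fun ω (_ : Unit) => hX.errorLp Δ t ω))
      exact hc.comap_le
    have h := condExp_indep_eq (f := hX.errorLp Δ t)
      (Lp.stronglyMeasurable (hX.errorLp Δ t)).measurable.comap_le hm
      (comap_measurable _).stronglyMeasurable (indep_of_indep_of_le_right hind hle).symm
    rwa [hX.integral_eq_zero (hX.errorLp_mem Δ t)] at h
  have h3 : P[((hX.predictor Δ t).2 : Ω → ℝ) | observedSigma X Δ] =ᵐ[P] (hX.predictor Δ t).2 := by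
    refine condExp_of_aestronglyMeasurable' hm ?_ (hi _)
    refine closure_minimal (s := (Submodule.span ℝ (hX.processLp '' Δ) : Set (Lp ℝ 2 P)))
      (t := {f : Lp ℝ 2 P | AEStronglyMeasurable[observedSigma X Δ] f P}) (fun ξ hξ => ?_)
      (isClosed_aestronglyMeasurable hm) (hX.predictor_snd_mem_image Δ t)
    have hle : Submodule.span ℝ (hX.processLp '' Δ) ≤ lpMeas ℝ ℝ (observedSigma X Δ) 2 P := by
      refine Submodule.span_le.2 ?_
      rintro _ ⟨u, hu, rfl⟩
      rw [SetLike.mem_coe, mem_lpMeas_iff_aestronglyMeasurable]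
      have hXu : Measurable[observedSigma X Δ] (X u) :=
        (comap_measurable (X u)).mono (le_iSup₂_of_le u hu le_rfl) le_rfl
      exact ⟨X u, hXu.stronglyMeasurable, hX.coeFn_processLp u⟩
    exact mem_lpMeas_iff_aestronglyMeasurable.1 (hle hξ)
  calc P[X t | observedSigma X Δ] =ᵐ[P]
        P[((hX.predictor Δ t).2 + hX.errorLp Δ t : Ω → ℝ) | observedSigma X Δ] :=
        condExp_congr_ae h1
    _ =ᵐ[P] P[((hX.predictor Δ t).2 : Ω → ℝ) | observedSigma X Δ] +
        P[(hX.errorLp Δ t : Ω → ℝ) | observedSigma X Δ] :=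
        condExp_add (hi _) (hi _) _
    _ =ᵐ[P] (hX.predictor Δ t).2 := by
        filter_upwards [h2, h3] with ω h2 h3
        rw [Pi.add_apply, h2, h3, add_zero]

theorem isWienerIntegral_condExp (t : TimeInterval T) :
    IsWienerIntegral P W (hX.predictor Δ t).1 (P[X t | observedSigma X Δ]) := by
  have hc := hX.condExp_eq_predictor Δ t
  have hξ : MemLp (P[X t | observedSigma X Δ]) 2 P := (memLp_congr_ae hc).2 (Lp.memLp _)
  rw [isWienerIntegral_iff hX.brownian (Lp.memLp _) hξ, Lp.toLp_coeFn]
  have : hξ.toLp = (hX.predictor Δ t).2 := Lp.ext (hξ.coeFn_toLp.trans hc)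
  rw [this]
  exact hX.closure_span_pair_le Δ (hX.predictor_mem Δ t)

theorem sub_condExp_eq_errorLp (t : TimeInterval T) :
    (fun ω => X t ω - (P[X t | observedSigma X Δ]) ω) =ᵐ[P] hX.errorLp Δ t := by
  filter_upwards [hX.coeFn_processLp t, hX.condExp_eq_predictor Δ t,
    Lp.coeFn_sub (hX.processLp t) (hX.predictor Δ t).2] with ω h1 h2 h3
  rw [errorLp, h3, Pi.sub_apply, h1, h2]

theorem covariance_sub_condExp (t s : TimeInterval T) :
    cov[fun ω => X t ω - (P[X t | observedSigma X Δ]) ω,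
      fun ω => X s ω - (P[X s | observedSigma X Δ]) ω; P] =
      ∫ u, (K t u - (hX.predictor Δ t).1 u) * (K s u - (hX.predictor Δ s).1 u) := by
  rw [hX.covariance_eq_inner (hX.errorLp_mem Δ t) (hX.sub_condExp_eq_errorLp Δ t)
    (hX.sub_condExp_eq_errorLp Δ s)]
  refine (inner_fst_eq_inner_snd_of_mem_closure_span hX.brownian.inner_pair
    (hX.sub_predictor_mem Δ t) (hX.sub_predictor_mem Δ s)).symm.trans ?_
  rw [L2.inner_def]
  refine integral_congr_ae ?_
  filter_upwards [(hX.fredholm t).1.coeFn_toLp, (hX.fredholm s).1.coeFn_toLp,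
    Lp.coeFn_sub (hX.kernelLp t) (hX.predictor Δ t).1,
    Lp.coeFn_sub (hX.kernelLp s) (hX.predictor Δ s).1] with u h1 h2 h3 h4
  have h1' : hX.kernelLp t u = K t u := h1
  have h2' : hX.kernelLp s u = K s u := h2
  simp only [pair, Prod.fst_sub]
  rw [h3, h4, Pi.sub_apply, Pi.sub_apply, h1', h2']
  simp [mul_comm]

end HasFredholmRepresentation

end Prediction

end

/-! ### The prediction law -/

theorem mainTheorem2 {T : ℝ} (hT : 0 < T)
    {Ω : Type*} [MeasurableSpace Ω] (P : Measure Ω) [IsProbabilityMeasure P]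
    (X : TimeInterval T → Ω → ℝ) (K : TimeInterval T → TimeInterval T → ℝ)
    (W : TimeInterval T → Ω → ℝ) (hX : HasFredholmRepresentation P X K W)
    (n : ℕ) (tL tU : Fin n → TimeInterval T)
    (hLU : ∀ i, tL i < tU i) (hUL : ∀ i j, i < j → tU i < tL j)
    (Δ : Set (TimeInterval T)) (hΔ : Δ = ⋃ i, Set.Icc (tL i) (tU i)) :
    ∃ f : TimeInterval T → TimeInterval T → ℝ,
      -- `f t` is the unique solution of the Fredholm system
      (∀ t ∉ Δ, IsPredictionKernel K Δ t (f t) ∧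
        ∀ g, IsPredictionKernel K Δ t g → g =ᵐ[volume] f t) ∧
      -- the predictor is the Wiener integral of `f t`
      (∀ t ∉ Δ, IsWienerIntegral P W (f t) (P[X t | observedSigma X Δ])) ∧
      -- the regular conditional law exists and is Gaussian with this mean and covariance
      ∃ κ : @Kernel Ω (TimeInterval T → ℝ) (observedSigma X Δ) MeasurableSpace.pi,
        IsRegularCondLaw P X (observedSigma X Δ) κ ∧
        (∀ ω, IsGaussianProcess (fun (t : TimeInterval T) (x : TimeInterval T → ℝ) => x t) (κ ω) ∧
          (∀ t ∉ Δ, ∫ x, x t ∂(κ ω) = (P[X t | observedSigma X Δ]) ω) ∧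
          (∀ t ∉ Δ, ∀ s ∉ Δ, cov[fun x => x t, fun x => x s; κ ω] =
            ∫ u, (K t u - f t u) * (K s u - f s u))) ∧
        -- every regular conditional law has almost surely the same finite-dimensional laws
        (∀ κ' : @Kernel Ω (TimeInterval T → ℝ) (observedSigma X Δ) MeasurableSpace.pi,
          IsRegularCondLaw P X (observedSigma X Δ) κ' → ∀ J : Finset (TimeInterval T),
            ∀ᵐ ω ∂P, (κ' ω).map J.restrict = (κ ω).map J.restrict) := by
  have hm := hX.observedSigma_le Δ
  -- Fixing the `condExp` version, measurable for the observed σ-algebra everywhere and not just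
  -- almost everywhere, lets mean and covariance hold for every ω.
  let M : Ω → TimeInterval T → ℝ := fun ω t => (P[X t | observedSigma X Δ]) ω
  let Y : Ω → TimeInterval T → ℝ := fun ω t => X t ω - M ω t
  have hM : Measurable[observedSigma X Δ] M :=
    @measurable_pi_lambda _ _ _ (observedSigma X Δ) _ _ fun t => stronglyMeasurable_condExp.measurable
  have hY : Measurable Y :=
    measurable_pi_iff.2 fun t =>
      (hX.measurable t).sub (stronglyMeasurable_condExp.measurable.mono hm le_rfl)
  have hYae : ∀ t, (fun ω => Y ω t) =ᵐ[P] hX.errorLp Δ t := hX.sub_condExp_eq_errorLp Δ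
  have hind := hX.indep_observedSigma Δ (Z := fun t ω => Y ω t) id hYae
  have hlaw := isRegularCondLaw_shiftKernel (X := X) hm hM hY hind fun t ω => by
    simp only [Y]
    ring
  have hκ : ∀ ω, @shiftKernel Ω (TimeInterval T) (observedSigma X Δ) M hM (P.map Y) _ ω =
      P.map (fun ω' => M ω + Y ω') := fun ω => by
    rw [@shiftKernel_apply _ _ (observedSigma X Δ), Measure.map_map (by fun_prop) hY]
    rfl
  have hMY : ∀ ω, Measurable fun ω' => M ω + Y ω' := fun ω => hY.const_add _
  have hYint : ∀ t, Integrable (fun ω => Y ω t) P := fun t =>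
    (((Lp.memLp (hX.errorLp Δ t)).integrable (by norm_num)).congr (hYae t).symm)
  have hgauss : IsGaussianProcess (fun t ω => Y ω t) P :=
    isGaussianProcess_of_forall_mem _ (fun ξ hξ => hX.map_eq_gaussianReal hξ) _
      (hX.errorLp Δ) (hX.errorLp_mem Δ) hYae
  refine ⟨fun t => (hX.predictor Δ t).1,
    fun t _ => ⟨hX.isPredictionKernel_predictor Δ t,
      fun g hg => hX.eq_predictor_of_isPredictionKernel Δ t hg⟩,
    fun t _ => hX.isWienerIntegral_condExp Δ t, _, hlaw, fun ω => ⟨⟨fun I => ⟨?_⟩⟩, ?_, ?_⟩,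
    fun κ' hκ' J => hlaw.ae_map_restrict_eq hm hκ' J⟩
  · have := (hgauss.hasGaussianLaw I).isGaussian_map
    have hI : Measurable fun ω' => I.restrict fun t => Y ω' t := by fun_prop
    have hR : Measurable fun x : TimeInterval T → ℝ => I.restrict fun t => x t := by fun_prop
    rw [hκ, Measure.map_map hR (hMY ω)]
    -- For fixed ω, each finite marginal is the Gaussian marginal of Y translated by a constant
    -- vector.
    have h : P.map ((fun x : TimeInterval T → ℝ => I.restrict fun t => x t) ∘
        fun ω' => M ω + Y ω') =
        (P.map fun ω' => I.restrict fun t => Y ω' t).map fun y => I.restrict (M ω) + y := by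
      rw [Measure.map_map (by fun_prop) hI]
      rfl
    rw [h]
    infer_instance
  · intro t _
    rw [hκ, integral_map (hMY ω).aemeasurable (measurable_pi_apply t).aestronglyMeasurable]
    simp only [Pi.add_apply]
    rw [integral_add (integrable_const _) (hYint t), integral_congr_ae (hYae t),
      hX.integral_eq_zero (hX.errorLp_mem Δ t)]
    simp [M]
  · intro t _ s _
    rw [hκ, covariance_map_fun (measurable_pi_apply t).aestronglyMeasurable
      (measurable_pi_apply s).aestronglyMeasurable (hMY ω).aemeasurable]
    simp only [Pi.add_apply]
    rw [covariance_const_add_left (hYint t), covariance_const_add_right (hYint s)]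
    exact hX.covariance_sub_condExp Δ t s
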